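/- **Theorem (Infinite base theorem).** None of the classes of forest languages $\mathrm{CTL}^*$, $FO[\prec]$, $\mathrm{PDL}$ and graded $\mathrm{PDL}$ has a finite algebraic base. Here the notions are as follows. *Forests.* Let $A$ be a finite alphabet. A forest over $A$ is a finite, possibly empty, sequence $t_1+\dots+t_k$ of trees, and a tree is an expression $as$ with $a\in A$ and $s$ a forest. Forests form a monoid $H_A$ under $+$ with neutral element the empty forest $0$. A context is a forest in which one leaf is replaced by a hole $\Box$; contexts form a monoid $V_A$ under substitution, which acts on $H_A$ by substitution. A forest language over $A$ is a subset of $H_A$. A class of forest languages associates to each finite alphabet $A$ a set of forest languages over $A$. *Forest algebras.* A forest algebra is a pair $(H,V)$ of monoids ($H$ written additively) with a faithful left monoid action of $V$ on the set $H$, such that for each $h\in H$ the maps $g\mapsto g+h$ and $g\mapsto h+g$ are given by elements of $V$. It is finite if $H$ and $V$ are finite. A homomorphism $(H,V)\to(H',V')$ is a pair of monoid homomorphisms compatible with the actions. The free forest algebra is $A^\Delta=(H_A,V_A)$. $(H,V)$ recognizes $L\subseteq H_A$ if $L=\alpha^{-1}(X)$ for some homomorphism $\alpha:A^\Delta\to(H,V)$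 and some $X\subseteq H$. The wreath product $(H_1,V_1)\circ(H_2,V_2)$ is the forest algebra with horizontal monoid $H_1\times H_2$, with vertical monoid $V_1\times V_2^{H_1}$ whose product is $(v,f)(v',f')=(vv',\,h\mapsto f(v'h)f'(h))$, and with the action $(v,f)(h_1,h_2)=(vh_1,f(h_1)h_2)$. *Bases.* A set $\mathscr A$ of forest algebras is an algebraic base of a class $\mathscr L$ of forest languages if, for every finite alphabet $A$, the languages over $A$ in $\mathscr L$ are exactly those recognized by the iterated wreath products $F_1\circ\dots\circ F_k$ ($k\ge1$, $F_i\in\mathscr A$). The base is finite if $\mathscr A$ is a finite set of finite forest algebras. *Logics.* $FO[\prec]$ is the class of languages defined by first-order sentences over the nodes of a forest, with a unary predicate for each label and the non-strict ancestor relation $\prec$. The formulas of graded $\mathrm{PDL}$ over $A$ are of two kinds. Tree formulas are the letters $a\in A$ (the root has label $a$), the forest formulas (true in a tree $as$ iff true in the forest $s$), and the boolean combinations of tree formulas. Forest formulas are $\mathbf T$, $\mathbf F$, the boolean combinations of forest formulas, and the formulas $\mathsf E^kL$, where $k>0$ and $L\subseteq\Phi^*$ is a regular word language over an alphabet $\Phi=\{\phi_1,\dots,\phi_{n+1}\}$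 obtained from tree formulas $\psi_1,\dots,\psi_n$ by $\phi_i=\psi_i\wedge\bigwedge_{j<i}\neg\psi_j$ for $i\le n$ and $\phi_{n+1}=\bigwedge_{j\le n}\neg\psi_j$. A forest satisfies $\mathsf E^kL$ if it has at least $k$ nodes $x$ such that the word obtained by reading along the path from a root to $x$ (both included), at each node, the unique $\phi_i$ satisfied by the subtree of that node, belongs to $L$. Graded $\mathrm{PDL}$ is the class of languages defined by forest formulas; $\mathrm{PDL}$ is its restriction to formulas in which only $k=1$ is used; $\mathrm{CTL}^*$ is the further restriction to formulas in which, moreover, all word languages $L$ are first-order definable (with the order of positions and letter predicates). -/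

import Mathlib

namespace ForestLogic

/-! ### Forests, nodes and contexts -/

/-- Finite ordered unranked forests with node labels in `A`. A forest is either the empty forest
`0`, or `a s + t`: a first tree, with root label `a` and with `s` as the forest of the subtrees
of the children of the root, followed by the forest `t` of the remaining trees. -/
inductive Forest (A : Type) : Type
  | nil : Forest A
  | cons (a : A) (s t : Forest A) : Forest A

namespace Forest

variable {A : Type}

/-- Concatenation of forests. -/
def append : Forest A → Forest A → Forest A
  | nil, u => u
  | cons a s t, u => cons a s (append t u)

instance : Zero (Forest A) := ⟨nil⟩

instance : Add (Forest A) := ⟨append⟩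

/-- Forests form a monoid under concatenation, written additively. -/
instance : AddMonoid (Forest A) where
  zero_add _ := rfl
  add_zero s := by
    change append s nil = s
    induction s with
    | nil => rfl
    | cons a s t _ ih => simp [append, ih]
  add_assoc s t u := by
    change append (append s t) u = append s (append t u)
    induction s with
    | nil => rfl
    | cons a s t _ ih => simp [append, ih]
  nsmul := nsmulRec

@[simp] theorem nil_eq_zero : (nil : Forest A) = 0 := rfl

@[simp] theorem cons_add (a : A) (s t u : Forest A) : cons a s t + u = cons a s (t + u) := rfl

/-- The nodes of a forest: for the forest `a s + t`, they are the root of the first tree, the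
nodes of `s`, and the nodes of `t`. -/
inductive Node : Forest A → Type
  | root {a : A} {s t : Forest A} : Node (cons a s t)
  | inside {a : A} {s t : Forest A} (x : Node s) : Node (cons a s t)
  | right {a : A} {s t : Forest A} (x : Node t) : Node (cons a s t)

namespace Node

/-- `path x` lists the nodes on the path from a root of the forest to `x` (both included). Each
node is recorded by its subtree, given as a pair of its label and its subforest. -/
def path : {f : Forest A} → Node f → List (A × Forest A)
  | cons a s _, root => [(a, s)]
  | cons a s _, inside x => (a, s) :: path x
  | cons _ _ _, right x => path x

/-- The label of a node. -/
def label : {f : Forest A} → Node f → A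
  | cons a _ _, root => a
  | cons _ _ _, inside x => label x
  | cons _ _ _, right x => label x

/-- The (non-strict) ancestor relation on the nodes of a forest. -/
inductive Ancestor : {f : Forest A} → Node f → Node f → Prop
  | root_root {a : A} {s t : Forest A} : Ancestor (root (a := a) (s := s) (t := t)) root
  | root_inside {a : A} {s t : Forest A} (y : Node s) :
      Ancestor (root (a := a) (s := s) (t := t)) (inside y)
  | inside_inside {a : A} {s t : Forest A} {x y : Node s} (h : Ancestor x y) :
      Ancestor (inside (a := a) (s := s) (t := t) x) (inside y)
  | right_right {a : A} {s t : Forest A} {x y : Node t} (h : Ancestor x y) :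
      Ancestor (right (a := a) (s := s) (t := t) x) (right y)

end Node

/-- The number of nodes. -/
def size : Forest A → ℕ
  | nil => 0
  | cons _ s t => size s + size t + 1

@[simp] theorem size_zero : size (0 : Forest A) = 0 := rfl

@[simp] theorem size_cons (a : A) (s t : Forest A) :
    size (cons a s t) = size s + size t + 1 := rfl

@[simp] theorem size_add (s t : Forest A) : size (s + t) = size s + size t := by
  induction s with
  | nil => simp
  | cons a s u _ ih => simp [ih]; omega

theorem add_cons_inj {N : ℕ} {a b : A} {x y r r' : Forest A} (l l' : Forest A)
    (h : l + cons a x r = l' + cons b y r') (hl : size l ≤ N) (hl' : size l' ≤ N)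
    (hx : N ≤ size x) (hy : N ≤ size y) : l = l' ∧ a = b ∧ x = y ∧ r = r' := by
  induction l generalizing l' with
  | nil =>
    cases l' with
    | nil => simpa using h
    | cons c u v =>
      simp at h hl'
      obtain ⟨-, rfl, -⟩ := h
      omega
  | cons c u v _ ih =>
    cases l' with
    | nil =>
      simp at h hl
      obtain ⟨-, rfl, -⟩ := h
      omega
    | cons c' u' v' =>
      simp at h hl hl'
      obtain ⟨rfl, rfl, h⟩ := h
      obtain ⟨rfl, h2⟩ := ih v' h (by omega) (by omega)
      exact ⟨rfl, h2⟩

theorem exists_size_eq (a : A) (n : ℕ) : ∃ s : Forest A, size s = n := by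
  induction n with
  | zero => exact ⟨0, rfl⟩
  | succ n ih =>
    obtain ⟨s, hs⟩ := ih
    exact ⟨cons a s 0, by simp [hs]⟩

end Forest

/-- A forest language over `A` is a set of forests over `A`. -/
abbrev ForestLanguage (A : Type) : Type := Set (Forest A)

/-- Contexts: forests in which one leaf is replaced by a hole. The hole is either at the top
level, `l + □ + r`, or inside one of the trees, `l + a p + r` with `p` a context. -/
inductive Context (A : Type) : Type
  | hole (l r : Forest A) : Context A
  | node (l : Forest A) (a : A) (p : Context A) (r : Forest A) : Context A

namespace Context

variable {A : Type}

/-- Substitution of a forest for the hole of a context. -/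
def plug : Context A → Forest A → Forest A
  | hole l r, s => l + s + r
  | node l a p r, s => l + Forest.cons a (plug p s) 0 + r

/-- Substitution of a context for the hole of a context. -/
def comp : Context A → Context A → Context A
  | hole l r, hole l' r' => hole (l + l') (r' + r)
  | hole l r, node l' a p r' => node (l + l') a p (r' + r)
  | node l a p r, q => node l a (comp p q) r

/-- Contexts form a monoid under composition, with the empty context `□` as identity. -/
instance : Monoid (Context A) where
  mul := comp
  one := hole 0 0
  one_mul p := by
    change comp (hole 0 0) p = p
    cases p <;> simp [comp]
  mul_one p := by
    change comp p (hole 0 0) = p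
    induction p with
    | hole l r => simp [comp]
    | node l a p r ih => simp [comp, ih]
  mul_assoc p q u := by
    change comp (comp p q) u = comp p (comp q u)
    induction p with
    | hole l r => cases q <;> cases u <;> simp [comp, add_assoc]
    | node l a p r ih => simp [comp, ih]

/-- The monoid of contexts acts on forests by substitution. -/
instance : MulAction (Context A) (Forest A) where
  smul := plug
  one_smul s := by
    change plug (hole 0 0) s = s
    simp [plug]
  mul_smul p q s := by
    change plug (comp p q) s = plug p (plug q s)
    induction p with
    | hole l r => cases q <;> simp [comp, plug, add_assoc]
    | node l a p r ih => simp [comp, plug, ih]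

/-- The number of nodes of a context, the hole not counted. -/
def size : Context A → ℕ
  | hole l r => l.size + r.size
  | node l _ p r => l.size + p.size + r.size + 1

theorem size_le_plug (p : Context A) (s : Forest A) : s.size ≤ (plug p s).size := by
  induction p with
  | hole l r => simp [plug]; omega
  | node l a p r ih => simp [plug]; omega

theorem plug_inj {a : A} {x : Forest A} (p q : Context A)
    (h : plug p (Forest.cons a x 0) = plug q (Forest.cons a x 0))
    (hp : p.size ≤ x.size) (hq : q.size ≤ x.size) : p = q := by
  induction p generalizing q with
  | hole l r =>
    cases q with
    | hole l' r' =>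
      simp only [plug, add_assoc, Forest.cons_add, zero_add, size] at h hp hq
      obtain ⟨rfl, -, -, rfl⟩ := Forest.add_cons_inj (N := x.size) l l' h
        (by omega) (by omega) le_rfl le_rfl
      rfl
    | node l' b q r' =>
      simp only [plug, add_assoc, Forest.cons_add, zero_add, size] at h hp hq
      have h3 := size_le_plug q (Forest.cons a x 0)
      simp at h3
      obtain ⟨-, -, h2, -⟩ := Forest.add_cons_inj (N := x.size) l l' h
        (by omega) (by omega) le_rfl (by omega)
      rw [← h2] at h3
      omega
  | node l b p r ih =>
    have h4 := size_le_plug p (Forest.cons a x 0)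
    simp at h4
    cases q with
    | hole l' r' =>
      simp only [plug, add_assoc, Forest.cons_add, zero_add, size] at h hp hq
      obtain ⟨-, -, h2, -⟩ := Forest.add_cons_inj (N := x.size) l l' h
        (by omega) (by omega) (by omega) le_rfl
      rw [h2] at h4
      omega
    | node l' c q r' =>
      simp only [plug, add_assoc, Forest.cons_add, zero_add, size] at h hp hq
      have h3 := size_le_plug q (Forest.cons a x 0)
      simp at h3
      obtain ⟨rfl, rfl, h2, rfl⟩ := Forest.add_cons_inj (N := x.size) l l' h
        (by omega) (by omega) (by omega) (by omega)
      rw [ih q h2 (by omega) (by omega)]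

instance : FaithfulSMul (Context A) (Forest A) where
  eq_of_smul_eq_smul {p q} h := by
    rcases isEmpty_or_nonempty A with hA | ⟨⟨a⟩⟩
    · have h0 : ∀ s : Forest A, s = 0 := fun s => by
        cases s with
        | nil => rfl
        | cons a _ _ => exact hA.elim a
      cases p with
      | hole l r =>
        cases q with
        | hole l' r' => rw [h0 l, h0 r, h0 l', h0 r']
        | node _ a _ _ => exact hA.elim a
      | node _ a _ _ => exact hA.elim a
    · obtain ⟨x, hx⟩ := Forest.exists_size_eq a (p.size + q.size)
      exact plug_inj p q (h (Forest.cons a x 0)) (by omega) (by omega)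

end Context

/-! ### Forest algebras -/

/-- A forest algebra `(H, V)`: a horizontal monoid `H` (written additively), a vertical monoid
`V`, and a faithful left monoid action of `V` on `H`, such that for every `h : H` the
translations `g ↦ g + h` and `g ↦ h + g` are given by elements of `V`. -/
structure ForestAlgebra where
  H : Type
  V : Type
  [addMonoidH : AddMonoid H]
  [monoidV : Monoid V]
  [mulAction : MulAction V H]
  [faithful : FaithfulSMul V H]
  exists_add_right : ∀ h : H, ∃ v : V, ∀ g : H, v • g = g + h
  exists_add_left : ∀ h : H, ∃ v : V, ∀ g : H, v • g = h + g

attribute [instance] ForestAlgebra.addMonoidH ForestAlgebra.monoidV ForestAlgebra.mulAction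
  ForestAlgebra.faithful

namespace ForestAlgebra

/-- A forest algebra is finite if both of its components are. -/
def IsFinite (F : ForestAlgebra) : Prop := Finite F.H ∧ Finite F.V

/-- A homomorphism of forest algebras is a pair of monoid homomorphisms that is compatible with
the actions. -/
structure Hom (F G : ForestAlgebra) where
  onH : F.H →+ G.H
  onV : F.V →* G.V
  map_smul : ∀ (v : F.V) (h : F.H), onH (v • h) = onV v • onH h

/-- The free forest algebra over the alphabet `A`, made of the forests and contexts over `A`. -/
def free (A : Type) : ForestAlgebra where
  H := Forest A
  V := Context A
  exists_add_right h := ⟨Context.hole 0 h, fun g => by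
    change Context.plug _ g = _
    simp [Context.plug]⟩
  exists_add_left h := ⟨Context.hole h 0, fun g => by
    change Context.plug _ g = _
    simp [Context.plug]⟩

/-- `F` recognizes `L` if `L` is the inverse image of some subset of the horizontal monoid of
`F` under some homomorphism from the free forest algebra to `F`. -/
def Recognizes (F : ForestAlgebra) {A : Type} (L : ForestLanguage A) : Prop :=
  ∃ (α : Hom (free A) F) (X : Set F.H), L = {s : Forest A | α.onH s ∈ X}

/-- The carrier `V₁ × V₂ ^ H₁` of the vertical monoid of the wreath product. -/
@[ext]
structure WreathV (F G : ForestAlgebra) where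
  fst : F.V
  snd : F.H → G.V

namespace WreathV

variable {F G : ForestAlgebra}

/-- `(v, f) (v', f') = (v v', h ↦ f (v' h) f' h)`. -/
instance : Monoid (WreathV F G) where
  mul x y := ⟨x.fst * y.fst, fun h => x.snd (y.fst • h) * y.snd h⟩
  one := ⟨1, fun _ => 1⟩
  one_mul x := WreathV.ext (one_mul _) (funext fun _ => one_mul _)
  mul_one x := WreathV.ext (mul_one _) (funext fun h => by
    change x.snd ((1 : F.V) • h) * 1 = x.snd h
    simp)
  mul_assoc x y z := WreathV.ext (mul_assoc _ _ _) (funext fun h => by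
    change x.snd (y.fst • z.fst • h) * y.snd (z.fst • h) * z.snd h
      = x.snd ((y.fst * z.fst) • h) * (y.snd (z.fst • h) * z.snd h)
    rw [mul_smul, mul_assoc])

/-- `(v, f) (h₁, h₂) = (v h₁, f h₁ h₂)`. -/
instance : MulAction (WreathV F G) (F.H × G.H) where
  smul x h := (x.fst • h.1, x.snd h.1 • h.2)
  one_smul h := by
    change ((1 : F.V) • h.1, (1 : G.V) • h.2) = h
    simp
  mul_smul x y h := by
    change ((x.fst * y.fst) • h.1, (x.snd (y.fst • h.1) * y.snd h.1) • h.2)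
      = (x.fst • y.fst • h.1, x.snd (y.fst • h.1) • y.snd h.1 • h.2)
    simp [mul_smul]

theorem smul_def (x : WreathV F G) (h : F.H × G.H) :
    x • h = (x.fst • h.1, x.snd h.1 • h.2) := rfl

instance : FaithfulSMul (WreathV F G) (F.H × G.H) where
  eq_of_smul_eq_smul {x y} hxy := by
    refine WreathV.ext ?_ (funext fun h₁ => ?_)
    · exact eq_of_smul_eq_smul (α := F.H) fun h => congrArg Prod.fst (hxy (h, 0))
    · exact eq_of_smul_eq_smul (α := G.H) fun h => congrArg Prod.snd (hxy (h₁, h))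

end WreathV

/-- The wreath product of two forest algebras. Its horizontal monoid is the direct product. -/
def wreath (F G : ForestAlgebra) : ForestAlgebra where
  H := F.H × G.H
  V := WreathV F G
  exists_add_right h := by
    obtain ⟨v, hv⟩ := F.exists_add_right h.1
    obtain ⟨w, hw⟩ := G.exists_add_right h.2
    exact ⟨⟨v, fun _ => w⟩, fun g => Prod.ext (hv g.1) (hw g.2)⟩
  exists_add_left h := by
    obtain ⟨v, hv⟩ := F.exists_add_left h.1
    obtain ⟨w, hw⟩ := G.exists_add_left h.2
    exact ⟨⟨v, fun _ => w⟩, fun g => Prod.ext (hv g.1) (hw g.2)⟩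

/-- The iterated wreath products `F₁ ∘ F₂ ∘ ⋯ ∘ Fₖ`, `k ≥ 1`, of members of `𝓑` (with repetitions
allowed). The wreath product being associative, they are bracketed to the left. -/
inductive IsIteratedWreath (𝓑 : Set ForestAlgebra) : ForestAlgebra → Prop
  | of {F : ForestAlgebra} (hF : F ∈ 𝓑) : IsIteratedWreath 𝓑 F
  | wreath {F G : ForestAlgebra} (hF : IsIteratedWreath 𝓑 F) (hG : G ∈ 𝓑) :
      IsIteratedWreath 𝓑 (F.wreath G)

end ForestAlgebra

/-- A class of forest languages: to each finite alphabet it associates a set of forest languages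
over this alphabet. -/
abbrev LanguageClass : Type 1 := (A : Type) → [Finite A] → Set (ForestLanguage A)

/-- The languages that are recognized by iterated wreath products of members of `𝓑`. -/
def generatedClass (𝓑 : Set ForestAlgebra) : LanguageClass := fun A _ =>
  {L : ForestLanguage A | ∃ F, ForestAlgebra.IsIteratedWreath 𝓑 F ∧ F.Recognizes L}

/-- `𝓑` is an algebraic base of the language class `C`. -/
def IsAlgebraicBase (𝓑 : Set ForestAlgebra) (C : LanguageClass) : Prop :=
  ∀ (A : Type) [Finite A], generatedClass 𝓑 A = C A

/-- The language class `C` has an algebraic base that consists of finitely many finite forest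
algebras. -/
def HasFiniteAlgebraicBase (C : LanguageClass) : Prop :=
  ∃ 𝓑 : Set ForestAlgebra, 𝓑.Finite ∧ (∀ F ∈ 𝓑, F.IsFinite) ∧ IsAlgebraicBase 𝓑 C

/-! ### First-order logic over forests and words -/

/-- The relation symbols: a unary predicate for every letter and one binary predicate. -/
inductive LabelRel (A : Type) : ℕ → Type
  | label (a : A) : LabelRel A 1
  | prec : LabelRel A 2

/-- The first-order signature with a unary predicate for every letter and one binary predicate. -/
def signature (A : Type) : FirstOrder.Language where
  Functions := fun _ => Empty
  Relations := LabelRel A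

/-- A forest as a relational structure: its elements are the nodes, the unary predicates are the
labels, and the binary predicate is the non-strict ancestor relation. -/
instance forestStructure {A : Type} (s : Forest A) : (signature A).Structure s.Node where
  funMap := fun f => nomatch f
  RelMap := fun r => match r with
    | LabelRel.label a => fun x => (x 0).label = a
    | LabelRel.prec => fun x => (x 0).Ancestor (x 1)

/-- The forest languages definable in first-order logic with the ancestor relation. -/
def FOPrec : LanguageClass := fun A _ =>
  {L : ForestLanguage A | ∃ φ : (signature A).Sentence,
    L = {s : Forest A | FirstOrder.Language.Sentence.Realize s.Node φ}}

/-- The positions of a word. -/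
def Pos {B : Type} (w : List B) : Type := Fin w.length

/-- A word as a relational structure: its elements are the positions, the unary predicates are
the labels, and the binary predicate is the strict order. -/
instance wordStructure {B : Type} (w : List B) : (signature B).Structure (Pos w) where
  funMap := fun f => nomatch f
  RelMap := fun r => match r with
    | LabelRel.label b => fun x => w.get (x 0) = b
    | LabelRel.prec => fun x => @LT.lt (Fin w.length) _ (x 0) (x 1)

/-- The word languages definable in first-order logic with the order. -/
def IsFODefinable {B : Type} (L : Language B) : Prop :=
  ∃ φ : (signature B).Sentence,
    ∀ w : List B, w ∈ L ↔ FirstOrder.Language.Sentence.Realize (Pos w) φ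

/-! ### Temporal logics -/

/-- A fragment of graded PDL is determined by the pairs of a threshold `k` and a word language
`L`, over the alphabet `Fin m`, for which the operator `E^k L` may be used. -/
abbrev Fragment : Type := (m : ℕ) → ℕ → Language (Fin m) → Prop

mutual

/-- Tree formulas of the fragment `R`. -/
inductive TreeFormula (A : Type) (R : Fragment) : Type
  | label (a : A) : TreeFormula A R
  | ofForest (φ : ForestFormula A R) : TreeFormula A R
  | neg (φ : TreeFormula A R) : TreeFormula A R
  | and (φ ψ : TreeFormula A R) : TreeFormula A R
  | or (φ ψ : TreeFormula A R) : TreeFormula A R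

/-- Forest formulas of the fragment `R`. In `E^k L`, the word language `L` is over the alphabet of
the `n + 1` members of the unambiguous set obtained from the tree formulas `ψ 0, …, ψ (n - 1)`;
these members are identified with their indices in `Fin (n + 1)`. -/
inductive ForestFormula (A : Type) (R : Fragment) : Type
  | tru : ForestFormula A R
  | fls : ForestFormula A R
  | neg (φ : ForestFormula A R) : ForestFormula A R
  | and (φ ψ : ForestFormula A R) : ForestFormula A R
  | or (φ ψ : ForestFormula A R) : ForestFormula A R
  | exPath (k : ℕ) (hk : 0 < k) {n : ℕ} (ψ : Fin n → TreeFormula A R)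
      (L : Language (Fin (n + 1))) (hL : R (n + 1) k L) : ForestFormula A R

end

/-- Satisfaction of the members of the unambiguous set obtained from `n` formulas, where `P j` says
that the `j`-th formula is satisfied. For `i < n`, the `i`-th member says that the `i`-th formula
holds and that no earlier one does; the last member says that none of the formulas holds. -/
def Unamb {n : ℕ} (P : Fin n → Prop) (i : Fin (n + 1)) : Prop :=
  (∀ j : Fin n, j.castSucc = i → P j) ∧ ∀ j : Fin n, j.castSucc < i → ¬ P j

theorem existsUnique_unamb {n : ℕ} (P : Fin n → Prop) : ∃! i, Unamb P i := by
  classical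
  have key : ∀ i i' : Fin (n + 1), Unamb P i → Unamb P i' → ¬ i < i' := by
    intro i i' h h' hlt
    have hi : i ≠ Fin.last n := (lt_of_lt_of_le hlt (Fin.le_last i')).ne
    obtain ⟨j, rfl⟩ := Fin.exists_castSucc_eq.2 hi
    exact h'.2 j hlt (h.1 j rfl)
  obtain ⟨i, hi⟩ : ∃ i, Unamb P i := by
    by_cases hP : ∃ j, P j
    · have hne : (Finset.univ.filter P).Nonempty := by
        obtain ⟨j, hj⟩ := hP
        exact ⟨j, by simpa using hj⟩
      refine ⟨((Finset.univ.filter P).min' hne).castSucc, fun j hj => ?_, fun j hj hPj => ?_⟩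
      · rw [Fin.castSucc_injective n hj]
        simpa using Finset.min'_mem _ hne
      · exact absurd (Finset.min'_le (Finset.univ.filter P) j (by simpa using hPj))
          (not_le.2 (Fin.castSucc_lt_castSucc_iff.1 hj))
    · push Not at hP
      exact ⟨Fin.last n, fun j hj => absurd hj (Fin.castSucc_lt_last j).ne, fun j _ => hP j⟩
  exact ⟨i, hi, fun i' hi' => le_antisymm (not_lt.1 (key _ _ hi hi')) (not_lt.1 (key _ _ hi' hi))⟩

mutual

/-- Tree satisfaction; the tree is given by its root label `a` and its subforest `s`. -/
def TreeFormula.Sat {A : Type} {R : Fragment} : TreeFormula A R → A → Forest A → Prop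
  | .label b, a, _ => a = b
  | .ofForest φ, _, s => φ.Sat s
  | .neg φ, a, s => ¬ φ.Sat a s
  | .and φ ψ, a, s => φ.Sat a s ∧ ψ.Sat a s
  | .or φ ψ, a, s => φ.Sat a s ∨ ψ.Sat a s

/-- Forest satisfaction. A forest satisfies `E^k L` if for at least `k` of its nodes the word that
labels the path from a root to the node belongs to `L`, where each node on the path is labelled by
the unique member of the unambiguous set that its subtree satisfies. -/
def ForestFormula.Sat {A : Type} {R : Fragment} : ForestFormula A R → Forest A → Prop
  | .tru, _ => True
  | .fls, _ => False
  | .neg φ, s => ¬ φ.Sat s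
  | .and φ ψ, s => φ.Sat s ∧ ψ.Sat s
  | .or φ ψ, s => φ.Sat s ∨ ψ.Sat s
  | .exPath k _ ψ L _, s =>
      (k : ℕ∞) ≤ Set.encard {x : s.Node | ∃ w ∈ L,
        List.Forall₂ (fun t i => Unamb (fun j => (ψ j).Sat t.1 t.2) i) x.path w}

end

/-- The forest languages definable by forest formulas of the fragment `R`. -/
def temporalClass (R : Fragment) : LanguageClass := fun A _ =>
  {L : ForestLanguage A | ∃ φ : ForestFormula A R, L = {s : Forest A | φ.Sat s}}

/-- Graded PDL: the operators `E^k L` with `L` regular. -/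
def GradedPDL : LanguageClass := temporalClass fun _ _ L => L.IsRegular

/-- PDL: the operators `E^1 L` with `L` regular. -/
def PDL : LanguageClass := temporalClass fun _ k L => k = 1 ∧ L.IsRegular

/-- CTL*: the operators `E^1 L` with `L` first-order definable. -/
def CTLStar : LanguageClass := temporalClass fun _ k L => k = 1 ∧ IsFODefinable L

end ForestLogic

namespace ForestLogic

/-! ### Walk languages -/

section Walk

variable {A : Type} (R : A → A → Prop) (T : A → Prop)

-- Read letters as edges of a graph: `src a` is the source state of `a`, and `tgt a` its target, or
-- `none` if `a` is an exit. `exitForests src tgt` asks for a path from a root that is a walk ending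
-- with an exit. For every number of states this language lies in all four classes, so it suffices
-- to find, for each finite base, one such language that its wreath products do not recognize.
--
-- Membership means that the set `starts` of a forest is nonempty, and this set is computed
-- bottom-up (`mem_starts_cons`). Take all edges, loops included, on `n` states and one exit per
-- state, with `n ≥ 2` larger than every horizontal monoid of the base. By induction on the number
-- of factors, every homomorphism to an iterated wreath product is constant on some `n` forests
-- whose starting sets are the complements of the `n` singletons (`exists_starts_eq_compl`). The
-- induction hypothesis makes all components but the last agree; by pigeonhole two of the forests
-- agree in the last one too; and `exists_starts_eq_compl_of_eq` spreads this one collision to a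
-- full family. Placing a suitable edge on top of two of these forests separates them by the
-- language, although their values agree.

/-- The words that are chains for `R` and contain a letter that satisfies `T`. -/
def walkWords : Language A := {w | w.IsChain R ∧ ∃ a ∈ w, T a}

/-- The forests in which some node has a path word in `walkWords R T`. -/
def walkForests : ForestLanguage A :=
  {s | ∃ x : s.Node, x.path.map Prod.fst ∈ walkWords R T}

variable {R T}

theorem mem_walkWords {w : List A} : w ∈ walkWords R T ↔ w.IsChain R ∧ ∃ a ∈ w, T a := Iff.rfl

theorem mem_walkForests {s : Forest A} :
    s ∈ walkForests R T ↔ ∃ x : s.Node, x.path.map Prod.fst ∈ walkWords R T := Iff.rfl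

theorem nil_notMem_walkWords : [] ∉ walkWords R T := by simp [mem_walkWords]

theorem singleton_mem_walkWords {a : A} : [a] ∈ walkWords R T ↔ T a := by simp [mem_walkWords]

/-- By `hRT` a letter with an `R`-successor fails `T`, so the head cannot be the witness for `T`.
Hence in a chain `T` holds at most at the last position. -/
theorem cons_cons_mem_walkWords (hRT : ∀ a b, R a b → ¬ T a) {a b : A} {w : List A} :
    a :: b :: w ∈ walkWords R T ↔ R a b ∧ b :: w ∈ walkWords R T := by
  have := hRT a b
  simp only [mem_walkWords, List.isChain_cons_cons, List.mem_cons (b := a), exists_eq_or_imp]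
  tauto

theorem getLast?_of_mem_walkWords (hRT : ∀ a b, R a b → ¬ T a) {w : List A}
    (hw : w ∈ walkWords R T) : ∃ a, w.getLast? = some a ∧ T a := by
  induction w with
  | nil => exact absurd hw nil_notMem_walkWords
  | cons a w ih =>
    cases w with
    | nil => exact ⟨a, rfl, singleton_mem_walkWords.1 hw⟩
    | cons b w =>
      obtain ⟨c, hc, hT⟩ := ih ((cons_cons_mem_walkWords hRT).1 hw).2
      exact ⟨c, by simpa using hc, hT⟩

open Classical in
/-- The automaton that remembers the last letter of an `R`-chain, with the initial state
`some none` and the sink `none`. -/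
noncomputable def walkDFA (R : A → A → Prop) (T : A → Prop) : DFA A (Option (Option A)) where
  step
    | none, _ => none
    | some none, b => some (some b)
    | some (some a), b => if R a b then some (some b) else none
  start := some none
  accept := {q | ∃ a, q = some (some a) ∧ T a}

theorem evalFrom_walkDFA_sink (w : List A) : (walkDFA R T).evalFrom none w = none := by
  induction w with
  | nil => rfl
  | cons a w ih => exact ih

/-- The automaton tests `T` on the last letter only, whereas a walk word may have its `T`-letter
anywhere; `hRT` makes the two conditions equivalent on chains. -/
theorem evalFrom_walkDFA (hRT : ∀ a b, R a b → ¬ T a) (a : A) (w : List A) :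
    (walkDFA R T).evalFrom (some (some a)) w ∈ (walkDFA R T).accept ↔
      a :: w ∈ walkWords R T := by
  induction w generalizing a with
  | nil =>
    rw [singleton_mem_walkWords]
    simp [walkDFA]
  | cons b w ih =>
    rw [cons_cons_mem_walkWords hRT, ← ih b, DFA.evalFrom_cons]
    by_cases h : R a b
    · simp only [h, true_and]
      rw [show (walkDFA R T).step (some (some a)) b = some (some b) by simp [walkDFA, h]]
    · simp only [h, false_and, iff_false]
      rw [show (walkDFA R T).step (some (some a)) b = none by simp [walkDFA, h],
        evalFrom_walkDFA_sink]
      simp [walkDFA]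

theorem isRegular_walkWords [Finite A] (hRT : ∀ a b, R a b → ¬ T a) :
    (walkWords R T).IsRegular := by
  have := Fintype.ofFinite A
  refine ⟨_, inferInstance, walkDFA R T, ?_⟩
  ext w
  rw [DFA.mem_accepts]
  cases w with
  | nil => simp [nil_notMem_walkWords, walkDFA, DFA.eval]
  | cons a w => exact evalFrom_walkDFA hRT a w

/-! ### First-order definability -/

open FirstOrder FirstOrder.Language

/-- The label of `t` belongs to `S`. -/
noncomputable def labelMem [Finite A] {k : ℕ} (S : A → Prop)
    (t : (signature A).Term (Empty ⊕ Fin k)) : (signature A).BoundedFormula Empty k :=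
  BoundedFormula.iSup fun a : {a // S a} =>
    Relations.boundedFormula₁ (L := signature A) (LabelRel.label a.1) t

/-- The labels of `t` and `u` are related by `S`. -/
noncomputable def labelRel [Finite A] {k : ℕ} (S : A → A → Prop)
    (t u : (signature A).Term (Empty ⊕ Fin k)) : (signature A).BoundedFormula Empty k :=
  BoundedFormula.iSup fun p : {p : A × A // S p.1 p.2} =>
    Relations.boundedFormula₁ (L := signature A) (LabelRel.label p.1.1) t ⊓
      Relations.boundedFormula₁ (L := signature A) (LabelRel.label p.1.2) u

/-- The binary predicate of the signature. -/
def prec {k : ℕ} (t u : (signature A).Term (Empty ⊕ Fin k)) :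
    (signature A).BoundedFormula Empty k :=
  Relations.boundedFormula₂ (L := signature A) LabelRel.prec t u

section Realize

variable {s : Forest A} {w : List A} {k : ℕ} (t u : (signature A).Term (Empty ⊕ Fin k))

theorem realize_labelMem_forest [Finite A] {S : A → Prop} {v : Empty → s.Node}
    {xs : Fin k → s.Node} :
    (labelMem S t).Realize v xs ↔ S (t.realize (Sum.elim v xs)).label := by
  refine BoundedFormula.realize_iSup.trans ⟨?_, fun h => ⟨⟨_, h⟩, ?_⟩⟩
  · rintro ⟨⟨a, ha⟩, h⟩
    obtain rfl : Forest.Node.label _ = a := BoundedFormula.realize_rel₁.1 h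
    exact ha
  · exact BoundedFormula.realize_rel₁.2 rfl

theorem realize_labelRel_forest [Finite A] {S : A → A → Prop} {v : Empty → s.Node}
    {xs : Fin k → s.Node} :
    (labelRel S t u).Realize v xs ↔
      S (t.realize (Sum.elim v xs)).label (u.realize (Sum.elim v xs)).label := by
  refine BoundedFormula.realize_iSup.trans ⟨?_, fun h => ⟨⟨(_, _), h⟩, ?_⟩⟩
  · rintro ⟨⟨⟨a, b⟩, hab⟩, h⟩
    rw [BoundedFormula.realize_inf] at h
    obtain rfl : Forest.Node.label _ = a := BoundedFormula.realize_rel₁.1 h.1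
    obtain rfl : Forest.Node.label _ = b := BoundedFormula.realize_rel₁.1 h.2
    exact hab
  · exact BoundedFormula.realize_inf.2
      ⟨BoundedFormula.realize_rel₁.2 rfl, BoundedFormula.realize_rel₁.2 rfl⟩

theorem realize_prec_forest {v : Empty → s.Node} {xs : Fin k → s.Node} :
    (prec t u).Realize v xs ↔
      (t.realize (Sum.elim v xs)).Ancestor (u.realize (Sum.elim v xs)) :=
  BoundedFormula.realize_rel₂

theorem realize_labelMem_word [Finite A] {S : A → Prop} {v : Empty → Pos w}
    {xs : Fin k → Pos w} :
    (labelMem S t).Realize v xs ↔ S (w.get (t.realize (M := Pos w) (Sum.elim v xs))) := by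
  refine BoundedFormula.realize_iSup.trans ⟨?_, fun h => ⟨⟨_, h⟩, ?_⟩⟩
  · rintro ⟨⟨a, ha⟩, h⟩
    obtain rfl : w.get _ = a := BoundedFormula.realize_rel₁.1 h
    exact ha
  · exact BoundedFormula.realize_rel₁.2 rfl

theorem realize_labelRel_word [Finite A] {S : A → A → Prop} {v : Empty → Pos w}
    {xs : Fin k → Pos w} :
    (labelRel S t u).Realize v xs ↔
      S (w.get (t.realize (M := Pos w) (Sum.elim v xs))) (w.get (u.realize (M := Pos w) (Sum.elim v xs))) := by
  refine BoundedFormula.realize_iSup.trans ⟨?_, fun h => ⟨⟨(_, _), h⟩, ?_⟩⟩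
  · rintro ⟨⟨⟨a, b⟩, hab⟩, h⟩
    rw [BoundedFormula.realize_inf] at h
    obtain rfl : w.get _ = a := BoundedFormula.realize_rel₁.1 h.1
    obtain rfl : w.get _ = b := BoundedFormula.realize_rel₁.1 h.2
    exact hab
  · exact BoundedFormula.realize_inf.2
      ⟨BoundedFormula.realize_rel₁.2 rfl, BoundedFormula.realize_rel₁.2 rfl⟩

theorem realize_prec_word {v : Empty → Pos w} {xs : Fin k → Pos w} :
    (prec t u).Realize v xs ↔
      @LT.lt (Fin w.length) _ (t.realize (M := Pos w) (Sum.elim v xs)) (u.realize (M := Pos w) (Sum.elim v xs)) :=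
  BoundedFormula.realize_rel₂

end Realize

theorem exists_sentence_word [Finite A] (R : A → A → Prop) (T : A → Prop) :
    ∃ φ : (signature A).Sentence, ∀ w : List A, Sentence.Realize (Pos w) φ ↔
      (∀ x y : Fin w.length, x < y → (∀ z, x < z → ¬ z < y) → R (w.get x) (w.get y)) ∧
        ∃ x : Fin w.length, T (w.get x) := by
  -- In the first conjunct `&0`, `&1`, `&2` are `x`, `y`, `z`: successor positions are those with
  -- nothing strictly between them.
  refine ⟨((prec (&0) (&1)).imp ((((prec (&0) (&2)).imp
    (prec (&2) (&1)).not).all).imp (labelRel R (&0) (&1)))).all.all ⊓ (labelMem T (&0)).ex,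
    fun w => ?_⟩
  simp only [Sentence.Realize, Formula.Realize, realize_labelMem_word, realize_labelRel_word,
    realize_prec_word,
    BoundedFormula.realize_inf, BoundedFormula.realize_ex, BoundedFormula.realize_all,
    BoundedFormula.realize_imp, BoundedFormula.realize_not]
  exact Iff.rfl

theorem exists_sentence_forest [Finite A] (R : A → A → Prop) (T : A → Prop) :
    ∃ φ : (signature A).Sentence, ∀ s : Forest A, Sentence.Realize s.Node φ ↔
      ∃ z : s.Node, (∀ x y : s.Node, y.Ancestor z → x.Ancestor y → ¬ x = y →
        (∀ u : s.Node, x.Ancestor u → u.Ancestor y → u = x ∨ u = y) → R x.label y.label) ∧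
          T z.label := by
  -- Here `&0`, `&1`, `&2`, `&3` are `z`, `x`, `y`, `u`; covering pairs of the ancestor order play
  -- the role of successor positions.
  refine ⟨(((prec (&2) (&0)).imp ((prec (&1) (&2)).imp ((&1 =' &2).not.imp
    ((((prec (&1) (&3)).imp ((prec (&3) (&2)).imp ((&3 =' &1) ⊔ (&3 =' &2)))).all).imp
      (labelRel R (&1) (&2)))))).all.all ⊓ labelMem T (&0)).ex, fun s => ?_⟩
  simp only [Sentence.Realize, Formula.Realize, realize_labelMem_forest,
    realize_labelRel_forest, realize_prec_forest,
    BoundedFormula.realize_inf, BoundedFormula.realize_ex, BoundedFormula.realize_all,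
    BoundedFormula.realize_imp, BoundedFormula.realize_not,
    BoundedFormula.realize_sup,
    BoundedFormula.realize_bdEqual]
  exact Iff.rfl

theorem isFODefinable_walkWords [Finite A] : IsFODefinable (walkWords R T) := by
  obtain ⟨φ, hφ⟩ := exists_sentence_word R T
  refine ⟨φ, fun w => ?_⟩
  rw [hφ, mem_walkWords, List.isChain_iff_getElem, List.exists_mem_iff_get]
  refine and_congr_left' ⟨fun h x y hxy hc => ?_, fun h i hi => ?_⟩
  · obtain ⟨x, hx⟩ := x
    obtain ⟨y, hy⟩ := y
    obtain rfl : y = x + 1 := by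
      by_contra hne
      exact hc ⟨x + 1, by simp at hxy; omega⟩ (by simp) (by simp at hxy ⊢; omega)
    exact h x hy
  · exact h ⟨i, by omega⟩ ⟨i + 1, hi⟩ (by simp) fun z hz hz' => by
      simp [Fin.lt_def] at hz hz'; omega

/-! ### Paths of nodes -/

open Forest Node

theorem ancestor_right_right {a : A} {s t : Forest A} {x y : t.Node} :
    (right (a := a) (s := s) x).Ancestor (right y) ↔ x.Ancestor y :=
  ⟨fun h => by cases h; assumption, .right_right⟩

theorem ancestor_inside_inside {a : A} {s t : Forest A} {x y : s.Node} :
    (inside (a := a) (t := t) x).Ancestor (inside y) ↔ x.Ancestor y :=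
  ⟨fun h => by cases h; assumption, .inside_inside⟩

theorem path_getLast? {s : Forest A} (x : s.Node) :
    (x.path.map Prod.fst).getLast? = some x.label := by
  induction x with
  | root => rfl
  | inside x ih => simp [path, label, List.getLast?_cons, ih]
  | right x ih => exact ih

/-- Some node that has no proper ancestor and lies above `z`. -/
theorem exists_top {s : Forest A} (z : s.Node) :
    ∃ y : s.Node, y.Ancestor z ∧ (∀ x : s.Node, x.Ancestor y → x = y) ∧
      (z.path.map Prod.fst).head? = some y.label := by
  induction z with
  | root => exact ⟨root, .root_root, fun x h => by cases h; rfl, rfl⟩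
  | inside z ih => exact ⟨root, .root_inside z, fun x h => by cases h; rfl, rfl⟩
  | right z ih =>
    obtain ⟨y, hy, hmax, hl⟩ := ih
    exact ⟨right y, .right_right hy, fun x h => by cases h with
      | right_right h => rw [hmax _ h], hl⟩

theorem head?_of_top {s : Forest A} {y z : s.Node} (hyz : y.Ancestor z)
    (hy : ∀ x : s.Node, x.Ancestor y → x = y) :
    (z.path.map Prod.fst).head? = some y.label := by
  induction hyz with
  | root_root => rfl
  | root_inside => rfl
  | inside_inside h _ => exact nomatch hy root (.root_inside _)
  | right_right h ih => exact ih fun x hx => by simpa using hy (right x) (.right_right hx)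

/-- The ancestors of `z` are linearly ordered and the path lists them downwards, so its adjacent
letters label the covering pairs. Below a new root, the only new covering pair consists of this root
and the topmost ancestor of `z`, whose label is the head of the old path; a tree added on the left
contributes nothing. -/
theorem isChain_path_iff {s : Forest A} (z : s.Node) :
    (z.path.map Prod.fst).IsChain R ↔ ∀ x y : s.Node, y.Ancestor z → x.Ancestor y → ¬ x = y →
        (∀ u : s.Node, x.Ancestor u → u.Ancestor y → u = x ∨ u = y) → R x.label y.label := by
  induction z with
  | root =>
    refine ⟨fun _ x y hy hx hne _ => ?_, fun _ => by simp [path]⟩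
    cases hy
    cases hx
    exact absurd rfl hne
  | @inside a s t z ih =>
    have hc : ((inside (a := a) (t := t) z).path.map Prod.fst).IsChain R ↔
        (∀ b ∈ (z.path.map Prod.fst).head?, R a b) ∧ (z.path.map Prod.fst).IsChain R := by
      rw [path, List.map_cons, List.isChain_cons]
    rw [hc, ih]
    constructor
    · rintro ⟨h0, h⟩ x y hy hx hne hcov
      cases hy with
      | root_inside =>
        cases hx
        exact absurd rfl hne
      | @inside_inside _ _ _ y _ hy =>
        cases hx with
        | root_inside =>
          refine h0 _ (head?_of_top hy fun x hx => ?_)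
          simpa using hcov (inside x) (.root_inside x) (.inside_inside hx)
        | inside_inside hx =>
          refine h _ _ hy hx (fun e => hne (e ▸ rfl)) fun u hu hu' => ?_
          simpa using hcov (inside u) (.inside_inside hu) (.inside_inside hu')
    · refine fun h => ⟨fun b hb => ?_, fun x y hy hx hne hcov => ?_⟩
      · obtain ⟨y, hy, hmax, hl⟩ := exists_top z
        obtain rfl : y.label = b := by simpa [hl] using hb
        refine h root (inside y) (.inside_inside hy) (.root_inside y) (by simp) fun u hu hu' => ?_
        cases hu' with
        | root_inside => exact .inl rfl
        | inside_inside hu' => exact .inr (by rw [hmax _ hu'])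
      · refine h (inside x) (inside y) (.inside_inside hy) (.inside_inside hx) (by simpa using hne)
          fun u hu hu' => ?_
        cases hu with
        | inside_inside hu => simpa using hcov _ hu (ancestor_inside_inside.1 hu')
  | @right a s t z ih =>
    refine ih.trans ⟨fun h x y hy hx hne hcov => ?_, fun h x y hy hx hne hcov => ?_⟩
    · cases hy with
      | right_right hy =>
        cases hx with
        | right_right hx =>
          refine h _ _ hy hx (fun e => hne (e ▸ rfl)) fun u hu hu' => ?_
          simpa using hcov (right u) (.right_right hu) (.right_right hu')
    · refine h (right x) (right y) (.right_right hy) (.right_right hx) (by simpa using hne)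
        fun u hu hu' => ?_
      cases hu with
      | right_right hu => simpa using hcov _ hu (ancestor_right_right.1 hu')

/-- By `hRT` the `T`-letter ends the path word, so it is the label of the node itself. -/
theorem walkForests_mem_FOPrec [Finite A] (hRT : ∀ a b, R a b → ¬ T a) :
    walkForests R T ∈ FOPrec A := by
  obtain ⟨φ, hφ⟩ := exists_sentence_forest R T
  refine ⟨φ, Set.ext fun s => ?_⟩
  rw [Set.mem_ofPred_eq, hφ, mem_walkForests]
  refine exists_congr fun z => ?_
  rw [← isChain_path_iff]
  refine ⟨fun h => ⟨h.1, ?_⟩, fun h => ⟨h.1, z.label, ?_, h.2⟩⟩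
  · obtain ⟨a, ha, hT⟩ := getLast?_of_mem_walkWords hRT h
    rw [path_getLast?] at ha
    cases ha
    exact hT
  · exact List.mem_of_getLast? (path_getLast? z)

end Walk

-- Path languages in the temporal fragments

/-- Tests for all letters but the last one suffice: the default member of the unambiguous set, where
every test fails, stands for the last letter. -/
theorem unamb_label_iff {m : ℕ} (a i : Fin (m + 1)) :
    Unamb (fun j : Fin m => a = j.castSucc) i ↔ a = i := by
  have h : Unamb (fun j : Fin m => a = j.castSucc) a :=
    ⟨fun _ hj => hj.symm, fun _ hj => hj.ne'⟩
  exact ⟨fun hi => (existsUnique_unamb _).unique h hi, fun e => e ▸ h⟩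

theorem setOf_exists_path_mem_temporalClass {Rf : Fragment} {m : ℕ} {K : Language (Fin (m + 1))}
    (hK : Rf (m + 1) 1 K) :
    {s : Forest (Fin (m + 1)) | ∃ x : s.Node, x.path.map Prod.fst ∈ K} ∈
      temporalClass Rf (Fin (m + 1)) := by
  refine ⟨.exPath 1 one_pos (fun j => .label j.castSucc) K hK, Set.ext fun s => ?_⟩
  simp only [Set.mem_ofPred_eq, ForestFormula.Sat, TreeFormula.Sat, unamb_label_iff, Nat.cast_one,
    Set.one_le_encard_iff_nonempty]
  refine exists_congr fun x => ?_
  have key : ∀ w, List.Forall₂ (fun (t : Fin (m + 1) × Forest (Fin (m + 1))) i => t.1 = i)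
      x.path w ↔ x.path.map Prod.fst = w := fun w => by
    rw [← List.forall₂_eq_eq_eq, List.forall₂_map_left_iff]
  simp [key]

/-! ### Walks between states -/

section States

open Forest

variable {A Q : Type} (src : A → Q) (tgt : A → Option Q)

/-- The walks in the graph with edges `A` that end with an edge without target. -/
abbrev exitWords : Language A := walkWords (fun a b => tgt a = some (src b)) fun a => tgt a = none

/-- The forests in which some node has a path word in `exitWords src tgt`. -/
abbrev exitForests : ForestLanguage A :=
  walkForests (fun a b => tgt a = some (src b)) fun a => tgt a = none

/-- The states in which a walk along a path of the forest may start. -/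
def starts (s : Forest A) : Set Q :=
  {q | ∃ x : s.Node, x.path.map Prod.fst ∈ exitWords src tgt ∧
    (x.path.map Prod.fst).head?.map src = some q}

variable {src tgt}

theorem mem_exitForests_iff {s : Forest A} :
    s ∈ exitForests src tgt ↔ (starts src tgt s).Nonempty := by
  refine ⟨fun ⟨x, hx⟩ => ?_, fun ⟨_, x, hx, _⟩ => ⟨x, hx⟩⟩
  obtain ⟨y, -, -, hy⟩ := exists_top x
  exact ⟨src y.label, x, hx, by simp [hy]⟩

theorem starts_zero : starts src tgt 0 = ∅ :=
  Set.eq_empty_of_forall_notMem fun _ ⟨x, _⟩ => nomatch x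

/-- Split off the first edge of the walk: either it is an exit, or the rest is a walk in the
subforest from its target. -/
theorem mem_starts_cons {a : A} {s t : Forest A} {q : Q} :
    q ∈ starts src tgt (cons a s t) ↔
      (q = src a ∧ (tgt a = none ∨ ∃ r ∈ starts src tgt s, tgt a = some r)) ∨
        q ∈ starts src tgt t := by
  have hRT : ∀ a b, tgt a = some (src b) → ¬ tgt a = none := fun a b h => by simp [h]
  constructor
  · rintro ⟨x, hx, hq⟩
    cases x with
    | root =>
      exact .inl ⟨by simpa [Node.path, eq_comm] using hq, .inl <|
        singleton_mem_walkWords (R := fun a b => tgt a = some (src b)).1 hx⟩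
    | inside x =>
      refine .inl ⟨by simpa [Node.path, eq_comm] using hq, .inr ?_⟩
      obtain ⟨y, -, -, hy⟩ := exists_top x
      obtain ⟨w, hw⟩ := List.head?_eq_some_iff.1 hy
      rw [Node.path, List.map_cons, hw, cons_cons_mem_walkWords hRT] at hx
      exact ⟨src y.label, ⟨x, hw ▸ hx.2, by simp [hy]⟩, hx.1⟩
    | right x => exact .inr ⟨x, hx, hq⟩
  · rintro (⟨rfl, h | ⟨r, ⟨x, hx, hr⟩, h⟩⟩ | ⟨x, hx, hq⟩)
    · exact ⟨.root, singleton_mem_walkWords.2 h, by simp [Node.path]⟩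
    · refine ⟨.inside x, ?_, by simp [Node.path]⟩
      obtain ⟨y, -, -, hy⟩ := exists_top x
      obtain ⟨w, hw⟩ := List.head?_eq_some_iff.1 hy
      rw [Node.path, List.map_cons, hw, cons_cons_mem_walkWords hRT, ← hw]
      refine ⟨?_, hx⟩
      rw [h, ← hr, hy, Option.map_some]
    · exact ⟨.right x, hx, hq⟩

theorem starts_add (s t : Forest A) :
    starts src tgt (s + t) = starts src tgt s ∪ starts src tgt t := by
  induction s with
  | nil => simp [starts_zero]
  | cons a s u _ ih =>
    ext q
    simp only [cons_add, mem_starts_cons, ih, Set.mem_union, or_assoc]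

theorem mem_starts_sum {l : List (Forest A)} {q : Q} :
    q ∈ starts src tgt l.sum ↔ ∃ s ∈ l, q ∈ starts src tgt s := by
  induction l with
  | nil => simp [starts_zero]
  | cons s l ih => simp [starts_add, ih]

end States

/-! ### Wreath products -/

namespace ForestAlgebra

open Forest

theorem Hom.onH_cons {A : Type} {F : ForestAlgebra} (α : Hom (free A) F) (a : A)
    (s : Forest A) :
    α.onH (cons a s 0) = α.onV (Context.node 0 a (Context.hole 0 0) 0) • α.onH s := by
  refine Eq.trans (congrArg α.onH ?_) (α.map_smul _ _)
  change _ = Context.plug _ _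
  simp [Context.plug]

theorem Hom.onH_sum_congr {A ι : Type} {F : ForestAlgebra} (α : Hom (free A) F) (l : List ι)
    {r r' : ι → Forest A} (h : ∀ i, α.onH (r i) = α.onH (r' i)) :
    α.onH (l.map r).sum = α.onH (l.map r').sum := by
  induction l with
  | nil => rfl
  | cons i l ih =>
    rw [List.map_cons, List.map_cons, List.sum_cons, List.sum_cons]
    exact (α.onH.map_add' _ _).trans ((congrArg₂ (· + ·) (h i) ih).trans (α.onH.map_add' _ _).symm)

/-- The first component of a homomorphism to a wreath product. -/
def Hom.wreathFst {E F G : ForestAlgebra} (α : Hom E (F.wreath G)) : Hom E F where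
  onH := (AddMonoidHom.fst F.H G.H).comp α.onH
  onV :=
    { toFun := fun v => (α.onV v).fst
      map_one' := congrArg WreathV.fst α.onV.map_one
      map_mul' := fun v w => congrArg WreathV.fst (α.onV.map_mul v w) }
  map_smul v h := congrArg Prod.fst (α.map_smul v h)

section

variable {n : ℕ} {A : Type}

/-- From forests `s i`, of which two are identified by `α`, one obtains forests with the same
sets of starting states that are all identified by `α`. -/
theorem exists_starts_eq_compl_of_eq (e : A ≃ Fin n × Option (Fin n)) {F : ForestAlgebra}
    (α : Hom (free A) F) {s : Fin n → Forest A}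
    (hs : ∀ i, starts (fun a => (e a).1) (fun a => (e a).2) (s i) = {i}ᶜ)
    {i₁ i₂ : Fin n} (hne : i₁ ≠ i₂) (hα : α.onH (s i₁) = α.onH (s i₂)) :
    ∃ h : F.H, ∀ i, ∃ t : Forest A,
      starts (fun a => (e a).1) (fun a => (e a).2) t = {i}ᶜ ∧ α.onH t = h := by
  classical
  -- One tree for each pair of states, with the edge from `p.1` to `p.2` as root above `r p`. A
  -- state starts a walk iff one of its edges leads to a starting state of the forest below.
  let P : (Fin n × Fin n → Forest A) → Forest A := fun r =>
    (Finset.univ.toList.map fun p : Fin n × Fin n =>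
      cons (e.symm (p.1, some p.2)) (r p) 0).sum
  have hP : ∀ r i, i ∈ starts (fun a => (e a).1) (fun a => (e a).2) (P r) ↔
      ∃ j, j ∈ starts (fun a => (e a).1) (fun a => (e a).2) (r (i, j)) := by
    intro r i
    simp only [P, mem_starts_sum, List.mem_map, Finset.mem_toList, Finset.mem_univ, true_and,
      exists_exists_eq_and, mem_starts_cons, starts_zero, Equiv.apply_symm_apply]
    simp
  have hPα : ∀ r r', (∀ p, α.onH (r p) = α.onH (r' p)) → α.onH (P r) = α.onH (P r') := by
    intro r r' h
    refine α.onH_sum_congr _ fun p => ?_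
    rw [Hom.onH_cons, Hom.onH_cons, h]
  -- With `s j` below each edge to `j`, no state starts, since `j` does not start in `s j`.
  -- Replacing `s i₁` by `s i₂` below the edge from a state to `i₁` lets that state start, because
  -- `i₁ ≠ i₂`, and `α` does not see the replacement. It is done for all states but `i`.
  refine ⟨α.onH (P fun p => s p.2), fun i =>
    ⟨P fun p => if p.2 = i₁ ∧ p.1 ≠ i then s i₂ else s p.2, ?_, hPα _ _ fun p => ?_⟩⟩
  · ext i'
    rw [hP]
    by_cases hi : i' = i
    · simp [hi, hs]
    · simp only [hi, Set.mem_compl_iff, Set.mem_singleton_iff, not_false_eq_true, iff_true]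
      exact ⟨i₁, by simp [hi, hs, hne]⟩
  · by_cases h : p.2 = i₁ ∧ p.1 ≠ i
    · exact (congrArg α.onH (if_pos h)).trans (hα.symm.trans (by rw [h.1]))
    · exact congrArg α.onH (if_neg h)

theorem exists_starts_eq_compl {𝓑 : Set ForestAlgebra} (e : A ≃ Fin n × Option (Fin n))
    (h𝓑 : ∀ G ∈ 𝓑, Finite G.H ∧ Nat.card G.H < n) {F : ForestAlgebra}
    (hF : IsIteratedWreath 𝓑 F) (α : Hom (free A) F) :
    ∃ h : F.H, ∀ i, ∃ t : Forest A,
      starts (fun a => (e a).1) (fun a => (e a).2) t = {i}ᶜ ∧ α.onH t = h := by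
  classical
  have pigeonhole : ∀ G ∈ 𝓑, ∀ f : Fin n → G.H, ∃ i j, i ≠ j ∧ f i = f j := by
    intro G hG f
    obtain ⟨_, hlt⟩ := h𝓑 G hG
    have := Fintype.ofFinite G.H
    obtain ⟨i, j, hij⟩ := Fintype.exists_ne_map_eq_of_card_lt f
      (by rwa [Fintype.card_fin, ← Nat.card_eq_fintype_card])
    exact ⟨i, j, hij⟩
  induction hF with
  | @of F hF =>
    -- The exits of all states except `i`, as single nodes.
    let s : Fin n → Forest A := fun i =>
      ((Finset.univ.erase i).toList.map fun j => cons (e.symm (j, none)) 0 0).sum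
    obtain ⟨i, j, hij, h⟩ := pigeonhole F hF fun i => α.onH (s i)
    refine exists_starts_eq_compl_of_eq e α (s := s) (fun i => ?_) hij h
    ext q
    simp [s, mem_starts_sum, mem_starts_cons, starts_zero]
  | @wreath F G hF hG ih =>
    obtain ⟨g, hg⟩ := ih α.wreathFst
    choose s hs hsg using hg
    -- The `F`-components already agree on the whole family, so a collision in `G.H` alone is a
    -- collision in the wreath product.
    obtain ⟨i, j, hij, h⟩ := pigeonhole G hG fun i => (α.onH (s i)).2
    exact exists_starts_eq_compl_of_eq e α hs hij
      (Prod.ext ((hsg i).trans (hsg j).symm) h)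

theorem exitForests_notMem_generatedClass [Finite A] {𝓑 : Set ForestAlgebra} (hn : 2 ≤ n)
    (e : A ≃ Fin n × Option (Fin n)) (h𝓑 : ∀ G ∈ 𝓑, Finite G.H ∧ Nat.card G.H < n) :
    exitForests (fun a => (e a).1) (fun a => (e a).2) ∉ generatedClass 𝓑 A := by
  rintro ⟨F, hF, α, X, hX⟩
  obtain ⟨h, hh⟩ := exists_starts_eq_compl e h𝓑 hF α
  choose t ht hα using hh
  let i₀ : Fin n := ⟨0, by omega⟩
  let i₁ : Fin n := ⟨1, by omega⟩
  -- The loop at `i₀` on top of `t i` can be continued to an exit iff `i₀` starts in `t i`, that is,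
  -- iff `i₀ ≠ i`.
  let c : Fin n → Forest A := fun i => cons (e.symm (i₀, some i₀)) (t i) 0
  have hc : ∀ i, c i ∈ exitForests (fun a => (e a).1) (fun a => (e a).2) ↔ i₀ ≠ i := by
    intro i
    rw [mem_exitForests_iff]
    simp [Set.Nonempty, c, mem_starts_cons, starts_zero, ht]
  have hmem : c i₀ ∈ exitForests (fun a => (e a).1) (fun a => (e a).2) ↔
      c i₁ ∈ exitForests (fun a => (e a).1) (fun a => (e a).2) := by
    rw [hX, Set.mem_ofPred_eq, Set.mem_ofPred_eq, Hom.onH_cons, Hom.onH_cons, hα, hα]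
  rw [hc, hc] at hmem
  exact hmem.2 (by simp [i₀, i₁]) rfl

end

end ForestAlgebra

-- From unrecognizable languages to the absence of finite bases

/-- Alphabets of the form `Fin (m + 1)` suffice, as the edges can be numbered; this is the shape of
the alphabets of the path operators. -/
theorem not_hasFiniteAlgebraicBase {C : LanguageClass}
    (hC : ∀ (m : ℕ) (Q : Type) (src : Fin (m + 1) → Q) (tgt : Fin (m + 1) → Option Q),
      exitForests src tgt ∈ C (Fin (m + 1))) :
    ¬ HasFiniteAlgebraicBase C := by
  rintro ⟨𝓑, hfin, hF, hbase⟩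
  obtain ⟨N, hN⟩ := (hfin.image fun G => Nat.card G.H).bddAbove
  replace hN : ∀ G ∈ 𝓑, Nat.card G.H ≤ N := fun G hG => hN (Set.mem_image_of_mem _ hG)
  -- With `N + 2` states there are more states than elements in any horizontal monoid of the base,
  -- and at least two, as the final separation requires.
  obtain ⟨m, hm⟩ : ∃ m, Fintype.card (Fin (N + 2) × Option (Fin (N + 2))) = m + 1 :=
    Nat.exists_eq_succ_of_ne_zero Fintype.card_ne_zero
  have e := (Fintype.equivFinOfCardEq hm).symm
  have hmem := hC m _ (fun a => (e a).1) fun a => (e a).2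
  rw [← hbase] at hmem
  exact ForestAlgebra.exitForests_notMem_generatedClass (by omega) e
    (fun G hG => ⟨(hF G hG).1, by have := hN G hG; omega⟩) hmem

end ForestLogic

theorem mainTheorem4 :
    ¬ ForestLogic.HasFiniteAlgebraicBase ForestLogic.CTLStar ∧
    ¬ ForestLogic.HasFiniteAlgebraicBase ForestLogic.FOPrec ∧
    ¬ ForestLogic.HasFiniteAlgebraicBase ForestLogic.PDL ∧
    ¬ ForestLogic.HasFiniteAlgebraicBase ForestLogic.GradedPDL := by
  open ForestLogic in
  have hRT {A Q : Type} (src : A → Q) (tgt : A → Option Q) (a b : A) :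
      tgt a = some (src b) → ¬ tgt a = none := fun h => by simp [h]
  exact ⟨not_hasFiniteAlgebraicBase fun m Q src tgt =>
      setOf_exists_path_mem_temporalClass ⟨rfl, isFODefinable_walkWords⟩,
    not_hasFiniteAlgebraicBase fun m Q src tgt => walkForests_mem_FOPrec (hRT src tgt),
    not_hasFiniteAlgebraicBase fun m Q src tgt =>
      setOf_exists_path_mem_temporalClass ⟨rfl, isRegular_walkWords (hRT src tgt)⟩,
    not_hasFiniteAlgebraicBase fun m Q src tgt =>
      setOf_exists_path_mem_temporalClass (isRegular_walkWords (hRT src tgt))⟩
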